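/- Let $K$ be a field and let $E=(E^0,E^1,r,s)$ be an arbitrary directed graph with $E^0\neq\emptyset$ (no restriction on the number of vertices or on the number of edges emitted by a vertex). The Leavitt path algebra $L_K(E)$ is the (not necessarily unital) $K$-algebra generated by pairwise orthogonal idempotents $v\in E^0$ and elements $e,e^*$ ($e\in E^1$) subject to $s(e)e=e=e\,r(e)$, $r(e)e^*=e^*=e^*s(e)$, $e^*e=r(e)$, $e^*f=0$ for $e\neq f$ in $E^1$, and $v=\sum_{s(e)=v}ee^*$ for every vertex $v$ with $0<|s^{-1}(v)|<\infty$. A simple left (right) $L_K(E)$-module is one with non-zero action and no proper non-zero submodules. A cycle is a path $e_1\cdots e_n$ with $n\ge 1$, $r(e_n)=s(e_1)$ and the $s(e_i)$ pairwise distinct; an exit for it is an edge $e$ such that $s(e)=s(e_i)$ and $e\neq e_i$ for some $i$. A vertex $v$ is a line point if no vertex $w$ that can be reached from $v$ by a path (of length $\ge 0$) emits more than one edge or lies on a cycle. Two infinite paths $e_1e_2\cdots$ and $f_1f_2\cdots$ are tail-equivalent if there are $m,n\geq 1$ with $e_{n+i}=f_{m+i}$ for all $i\ge 1$. 1. If $L_K(E)$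 has at most countably many isomorphism classes of simple left modules, or at most countably many isomorphism classes of simple right modules, then $E$ contains a line point or a cycle without exits (or both). 2. If $E$ contains no line point and no cycle without exits, then $E$ has $2^{\aleph_0}$ infinite paths that are pairwise not tail-equivalent. -/

import Mathlib

universe u v w

set_option linter.checkUnivs false

/-- An arbitrary directed graph `(E⁰, E¹, s, r)`: loops, multiple edges, infinitely many vertices
and infinite emitters are all allowed. -/
structure DirectedGraph where
  /-- the set of vertices -/
  Vertex : Type u
  /-- the set of edges -/
  Edge : Type v
  /-- the source of an edge -/
  s : Edge → Vertex
  /-- the range of an edge -/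
  r : Edge → Vertex

namespace DirectedGraph

variable (E : DirectedGraph.{u, v})

/-- The set of edges emitted by a vertex. -/
def emitted (x : E.Vertex) : Set E.Edge := {e | E.s e = x}

/-- A regular vertex emits at least one and only finitely many edges. -/
def IsRegular (x : E.Vertex) : Prop := (E.emitted x).Nonempty ∧ (E.emitted x).Finite

/-- `x ≥ y`: there is a path, possibly of length zero, from `x` to `y`. -/
def Reaches : E.Vertex → E.Vertex → Prop :=
  Relation.ReflTransGen fun x y => ∃ e : E.Edge, E.s e = x ∧ E.r e = y

/-- The tree `T(x)` of a vertex. -/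
def tree (x : E.Vertex) : Set E.Vertex := {y | E.Reaches x y}

/-- There is a bifurcation at `x`: the vertex `x` emits more than one edge. -/
def IsBifurcation (x : E.Vertex) : Prop := (E.emitted x).Nontrivial

/-- The list of edges `e₁, …, eₙ` is a cycle based at `x`: `n ≥ 1`, `r(eᵢ) = s(eᵢ₊₁)`,
`r(eₙ) = s(e₁) = x`, and the sources `s(eᵢ)` are pairwise distinct. -/
def IsCycleAt (x : E.Vertex) (c : List E.Edge) : Prop :=
  c.IsChain (fun e f => E.r e = E.s f) ∧
    (∃ e ∈ c.head?, E.s e = x) ∧ (∃ e ∈ c.getLast?, E.r e = x) ∧ (c.map E.s).Nodup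

/-- The edge `e` is an exit for the path `c`: it has the source of an edge of `c` different
from it. -/
def IsExit (c : List E.Edge) (e : E.Edge) : Prop := ∃ f ∈ c, E.s e = E.s f ∧ e ≠ f

/-- A line point: no vertex of its tree is a bifurcation or the base of a cycle. -/
def IsLinePoint (x : E.Vertex) : Prop :=
  ∀ y ∈ E.tree x, ¬ E.IsBifurcation y ∧ ¬ ∃ c : List E.Edge, E.IsCycleAt y c

/-- `E` contains a cycle without exits. -/
def HasCycleWithoutExits : Prop :=
  ∃ (x : E.Vertex) (c : List E.Edge), E.IsCycleAt x c ∧ ∀ e, ¬ E.IsExit c e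

/-- An infinite path `e₁e₂e₃⋯`; here the numbering of the edges starts at `0`. -/
structure InfinitePath where
  /-- the edges of the path -/
  edge : ℕ → E.Edge
  composable : ∀ i, E.r (edge i) = E.s (edge (i + 1))

/-- Two infinite paths are tail-equivalent if they agree after deleting suitable initial
segments. -/
def TailEquivalent (p q : E.InfinitePath) : Prop :=
  ∃ m n : ℕ, 0 < m ∧ 0 < n ∧ ∀ i, p.edge (n + i) = q.edge (m + i)

/-- The generators of the Leavitt path algebra: vertices, edges and ghost edges. -/
inductive Generator
  | vertex (x : E.Vertex)
  | edge (e : E.Edge)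
  | ghost (e : E.Edge)

variable (K : Type w) [Field K]

/-- The free (associative, not necessarily unital) `K`-algebra on the generators, realised as the
semigroup algebra of the free semigroup. -/
abbrev FreeLeavitt := MonoidAlgebra K (FreeSemigroup E.Generator)

namespace FreeLeavitt

variable {E}

/-- A generator, as an element of the free algebra. -/
noncomputable def gen (g : E.Generator) : E.FreeLeavitt K :=
  MonoidAlgebra.single (FreeSemigroup.of g) 1

/-- A vertex, as an element of the free algebra. -/
noncomputable abbrev vert (x : E.Vertex) : E.FreeLeavitt K := gen K (.vertex x)

/-- An edge, as an element of the free algebra. -/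
noncomputable abbrev real (e : E.Edge) : E.FreeLeavitt K := gen K (.edge e)

/-- A ghost edge `e*`, as an element of the free algebra. -/
noncomputable abbrev star (e : E.Edge) : E.FreeLeavitt K := gen K (.ghost e)

end FreeLeavitt

open FreeLeavitt in
/-- The defining relations of the Leavitt path algebra. The algebra has no unit in general, so the
last clause is what makes the congruence generated by them `K`-linear. -/
inductive LeavittRel : E.FreeLeavitt K → E.FreeLeavitt K → Prop
  | vert_idem (x : E.Vertex) : LeavittRel (vert K x * vert K x) (vert K x)
  | vert_orth (x y : E.Vertex) : x ≠ y → LeavittRel (vert K x * vert K y) 0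
  | source_edge (e : E.Edge) : LeavittRel (vert K (E.s e) * real K e) (real K e)
  | edge_range (e : E.Edge) : LeavittRel (real K e * vert K (E.r e)) (real K e)
  | range_ghost (e : E.Edge) : LeavittRel (vert K (E.r e) * star K e) (star K e)
  | ghost_source (e : E.Edge) : LeavittRel (star K e * vert K (E.s e)) (star K e)
  | ck1_same (e : E.Edge) : LeavittRel (star K e * real K e) (vert K (E.r e))
  | ck1_ne (e f : E.Edge) : e ≠ f → LeavittRel (star K e * real K f) 0
  | ck2 (x : E.Vertex) (hx : E.IsRegular x) :
      LeavittRel (vert K x) (∑ e ∈ hx.2.toFinset, real K e * star K e)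
  | smul (k : K) (a b : E.FreeLeavitt K) : LeavittRel a b → LeavittRel (k • a) (k • b)

/-- The Leavitt path algebra `L_K(E)`: the quotient of the free (not necessarily unital)
`K`-algebra by the ideal generated by the defining relations. -/
def LeavittPathAlgebra : Type (max u v w) := (ringConGen (E.LeavittRel K)).Quotient

noncomputable instance : NonUnitalRing (E.LeavittPathAlgebra K) :=
  inferInstanceAs (NonUnitalRing (ringConGen (E.LeavittRel K)).Quotient)

theorem leavittCon_smul (k : K) {a b : E.FreeLeavitt K} (h : ringConGen (E.LeavittRel K) a b) :
    ringConGen (E.LeavittRel K) (k • a) (k • b) := by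
  change RingConGen.Rel _ _ _ at h ⊢
  induction h with
  | of a b hab => exact .of _ _ (.smul k a b hab)
  | refl a => exact .refl _
  | symm _ ih => exact ih.symm
  | trans _ _ ih₁ ih₂ => exact ih₁.trans ih₂
  | add _ _ ih₁ ih₂ => simpa only [smul_add] using ih₁.add ih₂
  | mul _ h₂ ih₁ _ => simpa only [smul_mul_assoc] using ih₁.mul h₂

noncomputable instance : SMul K (E.LeavittPathAlgebra K) :=
  ⟨fun k => Quotient.map' (fun a => k • a) fun _ _ h => E.leavittCon_smul K k h⟩

noncomputable instance : Module K (E.LeavittPathAlgebra K) where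
  one_smul := by
    rintro ⟨a⟩; exact congrArg (Quot.mk _) (one_smul K a)
  mul_smul := by
    rintro k l ⟨a⟩; exact congrArg (Quot.mk _) (mul_smul k l a)
  smul_zero k := congrArg (Quot.mk _) (smul_zero (A := E.FreeLeavitt K) k)
  smul_add := by
    rintro k ⟨a⟩ ⟨b⟩; exact congrArg (Quot.mk _) (smul_add k a b)
  add_smul := by
    rintro k l ⟨a⟩; exact congrArg (Quot.mk _) (add_smul k l a)
  zero_smul := by
    rintro ⟨a⟩; exact congrArg (Quot.mk _) (zero_smul K a)

instance : IsScalarTower K (E.LeavittPathAlgebra K) (E.LeavittPathAlgebra K) :=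
  ⟨by rintro k ⟨a⟩ ⟨b⟩; exact congrArg (Quot.mk _) (smul_mul_assoc k a b)⟩

instance : SMulCommClass K (E.LeavittPathAlgebra K) (E.LeavittPathAlgebra K) :=
  ⟨by rintro k ⟨a⟩ ⟨b⟩; exact congrArg (Quot.mk _) (mul_smul_comm k a b).symm⟩

end DirectedGraph

/-- A simple left module over a ring `A` that need not have a unit: an abelian group `M`, a ring
homomorphism from `A` to the additive endomorphisms of `M` (the action) with `A M ≠ 0`, such that
the only submodules are `0` and `M`. Over a `K`-algebra with local units, such as a Leavitt path
algebra, such a module has a unique compatible `K`-vector space structure, and all submodules and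
isomorphisms respect it. Every simple `A`-module is a quotient of `A`, so
nothing is lost by taking `M` in the universe of `A`. Simple right `A`-modules are simple left
modules over `Aᵐᵒᵖ`. -/
structure SimpleLeftModule (A : Type u) [NonUnitalRing A] where
  /-- the underlying set -/
  carrier : Type u
  /-- the underlying abelian group -/
  [addCommGroup : AddCommGroup carrier]
  /-- the action -/
  act : A →ₙ+* AddMonoid.End carrier
  exists_act_ne_zero : ∃ (a : A) (m : carrier), act a m ≠ 0
  eq_bot_or_eq_top : ∀ N : AddSubgroup carrier, (∀ (a : A), ∀ m ∈ N, act a m ∈ N) → N = ⊥ ∨ N = ⊤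

attribute [instance] SimpleLeftModule.addCommGroup

namespace SimpleLeftModule

variable (A : Type u) [NonUnitalRing A]

/-- Isomorphism of simple modules, as an equivalence relation. -/
def isoSetoid : Setoid (SimpleLeftModule A) where
  r M N := ∃ f : M.carrier ≃+ N.carrier, ∀ (a : A) (m : M.carrier), f (M.act a m) = N.act a (f m)
  iseqv :=
    { refl := fun M => ⟨AddEquiv.refl _, fun _ _ => rfl⟩
      symm := by
        rintro M N ⟨f, hf⟩
        exact ⟨f.symm, fun a m => f.injective (by simp [hf])⟩
      trans := by
        rintro M N P ⟨f, hf⟩ ⟨g, hg⟩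
        exact ⟨f.trans g, fun a m => by simp [hf, hg]⟩ }

/-- The isomorphism classes of simple left `A`-modules. -/
def IsoClass : Type (u + 1) := Quotient (isoSetoid A)

end SimpleLeftModule

/-- `A` has at most countably many isomorphism classes of simple left modules. -/
def IsLeftCIRT (A : Type u) [NonUnitalRing A] : Prop := Countable (SimpleLeftModule.IsoClass A)

/-- `A` has at most countably many isomorphism classes of simple right modules. -/
def IsRightCIRT (A : Type u) [NonUnitalRing A] : Prop :=
  Countable (SimpleLeftModule.IsoClass Aᵐᵒᵖ)

/-! Without line points and exitless cycles every vertex reaches a bifurcation: a cycle that it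
reaches has an exit, and the source of the exit is one. So from a fixed vertex a 0-1 sequence steers
an infinite path, one bit being spent at each bifurcation met, and distinct sequences give distinct
paths (`path_injective`). A tail class contains only countably many of these paths, since two shifts
and finitely many bits determine each member. Hence there are continuum many classes, which is part
2.

For part 1, the span of a tail class is a Chen module. Ghost edges along a path `q` kill every other
basis path after finitely many steps. This isolates one basis vector in any nonzero submodule, which
gives simplicity, and it recovers the class from the isomorphism type. So part 2 yields uncountably
many simple left modules; the involution exchanging edges and ghost edges carries them to the right.
-/

namespace DirectedGraph

variable {E : DirectedGraph.{u, v}}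

/-! ### Infinite paths and tail equivalence -/

namespace InfinitePath

theorem ext {p q : E.InfinitePath} (h : ∀ i, p.edge i = q.edge i) : p = q := by
  cases p; cases q
  congr
  exact funext h

/-- The source of an infinite path. -/
def source (p : E.InfinitePath) : E.Vertex := E.s (p.edge 0)

/-- The infinite path without its first `n` edges. -/
def drop (n : ℕ) (p : E.InfinitePath) : E.InfinitePath where
  edge i := p.edge (n + i)
  composable i := p.composable (n + i)

/-- The infinite path with a further edge put in front. -/
def cons (e : E.Edge) (p : E.InfinitePath) (h : E.r e = p.source) : E.InfinitePath where
  edge i := Nat.casesOn i e p.edge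
  composable
    | 0 => h
    | i + 1 => p.composable i

theorem drop_one_cons (e : E.Edge) (p : E.InfinitePath) (h : E.r e = p.source) :
    (cons e p h).drop 1 = p :=
  ext fun i => by simp [drop, cons, Nat.add_comm 1 i]

theorem source_drop_one (p : E.InfinitePath) : (p.drop 1).source = E.r (p.edge 0) :=
  (p.composable 0).symm

theorem cons_drop_one (p : E.InfinitePath) (h : E.r (p.edge 0) = (p.drop 1).source) :
    cons (p.edge 0) (p.drop 1) h = p :=
  ext fun i => by cases i <;> simp [drop, cons, Nat.add_comm]

theorem drop_drop (m n : ℕ) (p : E.InfinitePath) : (p.drop m).drop n = p.drop (m + n) :=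
  ext fun i => by simp [drop, Nat.add_assoc]

end InfinitePath

namespace TailEquivalent

theorem refl (p : E.InfinitePath) : E.TailEquivalent p p :=
  ⟨1, 1, one_pos, one_pos, fun _ => rfl⟩

theorem symm {p q : E.InfinitePath} : E.TailEquivalent p q → E.TailEquivalent q p := by
  rintro ⟨m, n, hm, hn, h⟩
  exact ⟨n, m, hn, hm, fun i => (h i).symm⟩

theorem trans {p q r : E.InfinitePath} :
    E.TailEquivalent p q → E.TailEquivalent q r → E.TailEquivalent p r := by
  rintro ⟨m, n, hm, hn, h⟩ ⟨m', n', hm', hn', h'⟩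
  refine ⟨m' + m, n + n', by omega, by omega, fun i => ?_⟩
  rw [Nat.add_assoc, h, show m + (n' + i) = n' + (m + i) by omega, h', Nat.add_assoc]

theorem drop (n : ℕ) (p : E.InfinitePath) : E.TailEquivalent p (p.drop n) :=
  -- Both shifts are enlarged by one because tail equivalence asks for positive shifts.
  ⟨1, n + 1, one_pos, n.succ_pos, fun i => by simp [InfinitePath.drop, Nat.add_assoc]⟩

theorem exists_drop_eq {p q : E.InfinitePath} (h : E.TailEquivalent p q) :
    ∃ m n, p.drop n = q.drop m := by
  obtain ⟨m, n, -, -, h⟩ := h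
  exact ⟨m, n, InfinitePath.ext h⟩

theorem cons (e : E.Edge) (p : E.InfinitePath) (h : E.r e = p.source) :
    E.TailEquivalent p (p.cons e h) := by
  simpa [InfinitePath.drop_one_cons] using (drop 1 (p.cons e h)).symm

end TailEquivalent

/-! ### Bifurcations and continuum many tail classes -/

section Bifurcation

theorem reaches_source_of_mem_chain {c : List E.Edge} {x : E.Vertex}
    (hc : c.IsChain fun e f => E.r e = E.s f) (hx : ∃ e ∈ c.head?, E.s e = x) :
    ∀ f ∈ c, E.Reaches x (E.s f) := by
  induction c generalizing x with
  | nil => simp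
  | cons e c ih =>
    obtain ⟨e', he', rfl⟩ := hx
    obtain rfl : e = e' := by simpa using he'
    intro f hf
    rcases List.mem_cons.1 hf with rfl | hf
    · exact Relation.ReflTransGen.refl
    · cases c with
      | nil => simp at hf
      | cons g c =>
        obtain ⟨hg, hc⟩ := List.isChain_cons_cons.1 hc
        exact (ih hc ⟨g, rfl, rfl⟩ f hf).head ⟨e, rfl, hg⟩

theorem exists_reaches_bifurcation (hl : ¬ ∃ x : E.Vertex, E.IsLinePoint x)
    (hc : ¬ E.HasCycleWithoutExits) (x : E.Vertex) : ∃ y, E.Reaches x y ∧ E.IsBifurcation y := by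
  have hx : ¬ E.IsLinePoint x := fun h => hl ⟨x, h⟩
  simp only [IsLinePoint, not_forall] at hx
  obtain ⟨y, hxy, h⟩ := hx
  by_cases hy : E.IsBifurcation y
  · exact ⟨y, hxy, hy⟩
  · obtain ⟨c, hcy⟩ : ∃ c, E.IsCycleAt y c := by tauto
    obtain ⟨e, f, hf, hef, hne⟩ : ∃ e, E.IsExit c e := by
      by_contra hce
      exact hc ⟨y, c, hcy, not_exists.1 hce⟩
    exact ⟨E.s f, hxy.trans (reaches_source_of_mem_chain hcy.1 hcy.2.1 f hf),
      e, hef, f, rfl, hne⟩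

/-- The vertex `x` reaches a bifurcation by a path of length `n`. -/
def BifurcatesAfter (E : DirectedGraph.{u, v}) : ℕ → E.Vertex → Prop
  | 0, x => E.IsBifurcation x
  | n + 1, x => ∃ e, E.s e = x ∧ E.BifurcatesAfter n (E.r e)

theorem exists_bifurcatesAfter {x y : E.Vertex} (hxy : E.Reaches x y) (hy : E.IsBifurcation y) :
    ∃ n, E.BifurcatesAfter n x := by
  induction hxy using Relation.ReflTransGen.head_induction_on with
  | refl => exact ⟨0, hy⟩
  | head h _ ih =>
    obtain ⟨e, he, rfl⟩ := h
    obtain ⟨n, hn⟩ := ih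
    exact ⟨n + 1, e, he, hn⟩

/-- Two edges out of every vertex, distinct at bifurcations and equal elsewhere, such that following
them from any vertex leads to a bifurcation in the number of steps given by `dist`. -/
structure BranchingData (E : DirectedGraph.{u, v}) where
  /-- the edge to follow -/
  next : E.Vertex → Bool → E.Edge
  /-- the distance to the next bifurcation -/
  dist : E.Vertex → ℕ
  s_next : ∀ x b, E.s (next x b) = x
  next_injective : ∀ x, dist x = 0 → Function.Injective (next x)
  dist_next_lt : ∀ x, dist x ≠ 0 → ∀ b, dist (E.r (next x b)) < dist x

theorem nonempty_branchingData (h : ∀ x : E.Vertex, ∃ n, E.BifurcatesAfter n x) :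
    Nonempty E.BranchingData := by
  classical
  have key : ∀ x : E.Vertex, ∃ f : Bool → E.Edge, (∀ b, E.s (f b) = x) ∧
      (Nat.find (h x) = 0 → Function.Injective f) ∧
      (Nat.find (h x) ≠ 0 → ∀ b, Nat.find (h (E.r (f b))) < Nat.find (h x)) := by
    intro x
    have hx := Nat.find_spec (h x)
    rcases hn : Nat.find (h x) with _ | n
    · rw [hn] at hx
      obtain ⟨e, he, f, hf, hef⟩ := hx
      refine ⟨fun b => cond b e f, by rintro (_ | _) <;> assumption, fun _ => ?_, by simp⟩
      rintro (_ | _) (_ | _) hb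
      · rfl
      · exact absurd hb.symm hef
      · exact absurd hb hef
      · rfl
    · rw [hn] at hx
      obtain ⟨e, he, hen⟩ := hx
      -- At positive distance both bits select the first edge of a shortest path to a bifurcation.
      exact ⟨fun _ => e, fun _ => he, by simp, fun _ _ =>
        Nat.lt_succ_of_le (Nat.find_min' _ hen)⟩
  choose f h₁ h₂ h₃ using key
  exact ⟨⟨f, fun x => Nat.find (h x), h₁, h₂, h₃⟩⟩

namespace BranchingData

variable (D : E.BranchingData) (x : E.Vertex)

/-- The vertex reached from `x` after `i` steps, and the number of bifurcations met before, if the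
bits of `a` are used one after the other to choose the edges at the bifurcations. -/
def state (a : ℕ → Bool) : ℕ → E.Vertex × ℕ
  | 0 => (x, 0)
  | i + 1 =>
    (E.r (D.next (state a i).1 (a (state a i).2)),
      if D.dist (state a i).1 = 0 then (state a i).2 + 1 else (state a i).2)

/-- The infinite path from `x` that branches according to the bits of `a`. -/
def path (a : ℕ → Bool) : E.InfinitePath where
  edge i := D.next (D.state x a i).1 (a (D.state x a i).2)
  composable i := (D.s_next (D.state x a (i + 1)).1 _).symm

theorem state_snd_le (a : ℕ → Bool) (i : ℕ) : (D.state x a i).2 ≤ i := by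
  induction i with
  | zero => exact le_rfl
  | succ i ih =>
    simp only [state]
    split <;> omega

/-- At most one bit is spent per step, so a step numbered below `m` reads a bit with index below
`m`. -/
theorem state_congr {a b : ℕ → Bool} {m : ℕ} (h : ∀ i < m, a i = b i) :
    ∀ i ≤ m, D.state x a i = D.state x b i := by
  intro i
  induction i with
  | zero => exact fun _ => rfl
  | succ i ih =>
    intro hi
    have hs := D.state_snd_le x a i
    simp only [state, ← ih (by omega), h _ (show (D.state x a i).2 < m by omega)]

theorem path_edge_congr {a b : ℕ → Bool} {m : ℕ} (h : ∀ i < m, a i = b i) {i : ℕ} (hi : i < m) :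
    (D.path x a).edge i = (D.path x b).edge i := by
  have hs := D.state_snd_le x a i
  simp only [path, ← D.state_congr x h i hi.le, h _ (show (D.state x a i).2 < m by omega)]

theorem exists_dist_state_eq_zero (a : ℕ → Bool) (i : ℕ) :
    ∃ j, D.dist (D.state x a j).1 = 0 ∧ (D.state x a j).2 = (D.state x a i).2 := by
  induction hd : D.dist (D.state x a i).1 using Nat.strong_induction_on generalizing i with
  | _ d ih =>
    by_cases h0 : D.dist (D.state x a i).1 = 0
    · exact ⟨i, h0, rfl⟩
    · obtain ⟨j, hj, hji⟩ := ih _ (hd ▸ D.dist_next_lt _ h0 (a (D.state x a i).2)) (i + 1) rfl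
      exact ⟨j, hj, by rw [hji, state, if_neg h0]⟩

/-- The distance drops until a bifurcation is met, so no bit is left unread. -/
theorem exists_state_snd_eq (a : ℕ → Bool) (k : ℕ) :
    ∃ j, D.dist (D.state x a j).1 = 0 ∧ (D.state x a j).2 = k := by
  induction k with
  | zero => exact D.exists_dist_state_eq_zero x a 0
  | succ k ih =>
    obtain ⟨i, hi, rfl⟩ := ih
    obtain ⟨j, hj, hji⟩ := D.exists_dist_state_eq_zero x a (i + 1)
    exact ⟨j, hj, by rw [hji, state, if_pos hi]⟩

/-- The edges determine the vertices, hence the bit counters too; at the bifurcation where bit `k`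
is read, the chosen edge reveals the bit. -/
theorem path_injective : Function.Injective (D.path x) := by
  intro a b hab
  have he : ∀ i, (D.path x a).edge i = (D.path x b).edge i := by simp [hab]
  have hs : ∀ i, D.state x a i = D.state x b i := by
    intro i
    induction i with
    | zero => rfl
    | succ i ih =>
      have hi := he i
      simp only [path] at hi
      simp only [state, hi]
      simp only [ih]
  funext k
  obtain ⟨j, hj, rfl⟩ := D.exists_state_snd_eq x a k
  have h := he j
  simp only [path, ← hs] at h
  exact D.next_injective _ hj h

/-- If the path agrees with `p` from edge `n` on, up to a shift, then the shifts and the first `n`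
bits determine it: the bits give its first `n` edges, and `p` gives the rest. -/
theorem countable_setOf_tailEquivalent (p : E.InfinitePath) :
    {a | E.TailEquivalent (D.path x a) p}.Countable := by
  have hex : ∀ a : {a | E.TailEquivalent (D.path x a) p}, ∃ c : ℕ × ℕ,
      ∀ i, (D.path x a).edge (c.1 + i) = p.edge (c.2 + i) :=
    fun ⟨a, m, n, _, _, h⟩ => ⟨(n, m), h⟩
  choose c hc using hex
  let F : {a | E.TailEquivalent (D.path x a) p} → (ℕ × ℕ) × List Bool := fun a =>
    (c a, (List.range (c a).1).map a)
  refine (Function.Injective.countable (f := F) fun a b hab => ?_ : Countable _)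
  simp only [F, Prod.mk.injEq] at hab
  obtain ⟨h₁, h₂⟩ := hab
  rw [← h₁] at h₂
  have h₃ : ∀ i < (c a).1, a.1 i = b.1 i := by simpa using h₂
  refine Subtype.ext (D.path_injective x (InfinitePath.ext fun i => ?_))
  rcases lt_or_ge i (c a).1 with hi | hi
  · exact D.path_edge_congr x h₃ hi
  · obtain ⟨j, rfl⟩ := Nat.exists_eq_add_of_le hi
    rw [hc, h₁, hc]

theorem exists_pairwise_not_tailEquivalent (D : E.BranchingData) (x : E.Vertex) :
    ∃ S : Set E.InfinitePath, Cardinal.mk S = Cardinal.continuum ∧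
      S.Pairwise fun p q => ¬ E.TailEquivalent p q := by
  let R : Setoid (ℕ → Bool) :=
    { r := fun a b => E.TailEquivalent (D.path x a) (D.path x b)
      iseqv := ⟨fun _ => .refl _, fun h => h.symm, fun h h' => h.trans h'⟩ }
  have hcard : Cardinal.mk (ℕ → Bool) = Cardinal.continuum := by simp
  have hfib : ∀ q : Quotient R, Cardinal.mk (Quotient.mk R ⁻¹' {q}) ≤ Cardinal.aleph0 := by
    intro q
    refine Cardinal.mk_le_aleph0_iff.2 (Set.Countable.mono ?_
      (D.countable_setOf_tailEquivalent x (D.path x q.out)))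
    intro a ha
    exact Quotient.exact (ha.trans q.out_eq.symm)
  -- The fibres are countable, so fewer than continuum many classes could not cover all bit
  -- sequences.
  have hle := Cardinal.mk_le_mk_mul_of_mk_preimage_le (Quotient.mk R) hfib
  have hQ : Cardinal.mk (Quotient R) = Cardinal.continuum := by
    refine le_antisymm (hcard ▸ Cardinal.mk_quotient_le) (not_lt.1 fun h => ?_)
    exact absurd hle (not_le.2 (hcard ▸ Cardinal.mul_lt_of_lt Cardinal.aleph0_le_continuum h
      Cardinal.aleph0_lt_continuum))
  let f : Quotient R → E.InfinitePath := fun q => D.path x q.out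
  have hf : Function.Injective f := (D.path_injective x).comp Quotient.out_injective
  refine ⟨Set.range f, ?_, ?_⟩
  · have h := Cardinal.mk_range_eq_of_injective hf
    rw [hQ] at h
    simpa using h
  · rintro _ ⟨q, rfl⟩ _ ⟨q', rfl⟩ hne h
    refine hne (congrArg f ?_)
    rw [← q.out_eq, ← q'.out_eq]
    exact Quotient.sound h

end BranchingData

end Bifurcation

end DirectedGraph


/-! ### Universal property of the Leavitt path algebra -/

namespace DirectedGraph

/-- Elements of a ring that satisfy the defining relations of the Leavitt path algebra. -/
structure LeavittFamily (E : DirectedGraph.{u, v}) (B : Type*) [NonUnitalRing B] where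
  /-- the image of a generator -/
  gen : E.Generator → B
  vert_idem : ∀ x, gen (.vertex x) * gen (.vertex x) = gen (.vertex x)
  vert_orth : ∀ x y, x ≠ y → gen (.vertex x) * gen (.vertex y) = 0
  source_edge : ∀ e, gen (.vertex (E.s e)) * gen (.edge e) = gen (.edge e)
  edge_range : ∀ e, gen (.edge e) * gen (.vertex (E.r e)) = gen (.edge e)
  range_ghost : ∀ e, gen (.vertex (E.r e)) * gen (.ghost e) = gen (.ghost e)
  ghost_source : ∀ e, gen (.ghost e) * gen (.vertex (E.s e)) = gen (.ghost e)
  ck1_same : ∀ e, gen (.ghost e) * gen (.edge e) = gen (.vertex (E.r e))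
  ck1_ne : ∀ e f, e ≠ f → gen (.ghost e) * gen (.edge f) = 0
  ck2 : ∀ x (hx : E.IsRegular x),
    gen (.vertex x) = ∑ e ∈ hx.2.toFinset, gen (.edge e) * gen (.ghost e)

variable {E : DirectedGraph.{u, v}}

/-- The involution on the generators that exchanges edges and ghost edges. -/
def Generator.star : E.Generator → E.Generator
  | .vertex x => .vertex x
  | .edge e => .ghost e
  | .ghost e => .edge e

theorem Generator.star_star (g : E.Generator) : g.star.star = g := by
  cases g <;> rfl

namespace LeavittFamily

/-- The family in the opposite ring that is obtained by exchanging edges and ghost edges. -/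
def op {B : Type*} [NonUnitalRing B] (F : E.LeavittFamily B) : E.LeavittFamily Bᵐᵒᵖ where
  gen g := .op (F.gen g.star)
  vert_idem x := congrArg MulOpposite.op (F.vert_idem x)
  vert_orth x y h := congrArg MulOpposite.op (F.vert_orth y x h.symm)
  source_edge e := congrArg MulOpposite.op (F.ghost_source e)
  edge_range e := congrArg MulOpposite.op (F.range_ghost e)
  range_ghost e := congrArg MulOpposite.op (F.edge_range e)
  ghost_source e := congrArg MulOpposite.op (F.source_edge e)
  ck1_same e := congrArg MulOpposite.op (F.ck1_same e)
  ck1_ne e f h := congrArg MulOpposite.op (F.ck1_ne f e h.symm)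
  ck2 x hx := (congrArg MulOpposite.op (F.ck2 x hx)).trans
    (map_sum (MulOpposite.opAddEquiv (α := B)) _ _)

variable (K : Type w) [Field K] {B : Type*} [NonUnitalRing B] [Module K B] [IsScalarTower K B B]
  [SMulCommClass K B B] (F : E.LeavittFamily B)

/-- The homomorphism from the free algebra given by a family. -/
noncomputable def freeLift : E.FreeLeavitt K →ₙₐ[K] B :=
  MonoidAlgebra.liftMagma K (FreeSemigroup.lift F.gen)

theorem freeLift_gen (g : E.Generator) : F.freeLift K (FreeLeavitt.gen K g) = F.gen g := by
  simp [freeLift, FreeLeavitt.gen]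

theorem freeLift_eq_of_leavittRel {a b : E.FreeLeavitt K} (h : E.LeavittRel K a b) :
    F.freeLift K a = F.freeLift K b := by
  induction h with
  | smul k a b _ ih => simp only [map_smul, ih]
  | vert_idem x => simpa only [map_mul, freeLift_gen] using F.vert_idem x
  | vert_orth x y h => simpa only [map_mul, map_zero, freeLift_gen] using F.vert_orth x y h
  | source_edge e => simpa only [map_mul, freeLift_gen] using F.source_edge e
  | edge_range e => simpa only [map_mul, freeLift_gen] using F.edge_range e
  | range_ghost e => simpa only [map_mul, freeLift_gen] using F.range_ghost e
  | ghost_source e => simpa only [map_mul, freeLift_gen] using F.ghost_source e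
  | ck1_same e => simpa only [map_mul, freeLift_gen] using F.ck1_same e
  | ck1_ne e f h => simpa only [map_mul, map_zero, freeLift_gen] using F.ck1_ne e f h
  | ck2 x hx => simpa only [map_sum, map_mul, freeLift_gen] using F.ck2 x hx

theorem freeLift_eq_of_ringConGen {a b : E.FreeLeavitt K}
    (h : ringConGen (E.LeavittRel K) a b) : F.freeLift K a = F.freeLift K b := by
  change RingConGen.Rel _ _ _ at h
  induction h with
  | of a b hab => exact F.freeLift_eq_of_leavittRel K hab
  | refl a => rfl
  | symm _ ih => exact ih.symm
  | trans _ _ ih₁ ih₂ => exact ih₁.trans ih₂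
  | add _ _ ih₁ ih₂ => rw [map_add, map_add, ih₁, ih₂]
  | mul _ _ ih₁ ih₂ => rw [map_mul, map_mul, ih₁, ih₂]

/-- The universal property of the Leavitt path algebra. -/
noncomputable def lift : E.LeavittPathAlgebra K →ₙ+* B where
  toFun := Quotient.lift (F.freeLift K) fun _ _ h => F.freeLift_eq_of_ringConGen K h
  map_zero' := map_zero (F.freeLift K)
  map_add' := by rintro ⟨a⟩ ⟨b⟩; exact map_add (F.freeLift K) a b
  map_mul' := by rintro ⟨a⟩ ⟨b⟩; exact map_mul (F.freeLift K) a b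

end LeavittFamily

/-- A multiple of a generator, as an element of the Leavitt path algebra. -/
noncomputable def LeavittPathAlgebra.smulGen (K : Type w) [Field K] (k : K) (g : E.Generator) :
    E.LeavittPathAlgebra K :=
  Quotient.mk (ringConGen (E.LeavittRel K)).toSetoid (k • FreeLeavitt.gen K g)

theorem LeavittFamily.lift_smulGen (K : Type w) [Field K] {B : Type*} [NonUnitalRing B]
    [Module K B] [IsScalarTower K B B] [SMulCommClass K B B] (F : E.LeavittFamily B) (k : K)
    (g : E.Generator) : F.lift K (LeavittPathAlgebra.smulGen K k g) = k • F.gen g :=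
  (map_smul (F.freeLift K) k _).trans (congrArg _ (F.freeLift_gen K g))

/-! ### Chen modules -/

/-- The infinite paths that are tail-equivalent to `p`; they form the basis of the Chen module. -/
structure TailClass (p : E.InfinitePath) : Type (max u v w) where
  /-- the infinite path -/
  path : E.InfinitePath
  tailEquivalent : E.TailEquivalent p path

namespace TailClass

variable {p : E.InfinitePath}

theorem ext {q q' : TailClass.{u, v, w} p} (h : q.path = q'.path) : q = q' := by
  cases q; cases q'; congr

/-- The infinite path `p` as an element of its class. -/
def self (p : E.InfinitePath) : TailClass.{u, v, w} p := ⟨p, .refl p⟩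

/-- Deletion of the first `n` edges. -/
def drop (n : ℕ) (q : TailClass.{u, v, w} p) : TailClass.{u, v, w} p :=
  ⟨q.path.drop n, q.tailEquivalent.trans (.drop n _)⟩

/-- Putting a further edge in front. -/
def cons (e : E.Edge) (q : TailClass.{u, v, w} p) (h : E.r e = q.path.source) :
    TailClass.{u, v, w} p :=
  ⟨q.path.cons e h, q.tailEquivalent.trans (.cons e _ h)⟩

theorem drop_one_cons (e : E.Edge) (q : TailClass.{u, v, w} p) (h : E.r e = q.path.source) :
    (q.cons e h).drop 1 = q :=
  ext (q.path.drop_one_cons e h)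

theorem source_drop_one (q : TailClass.{u, v, w} p) :
    (q.drop 1).path.source = E.r (q.path.edge 0) :=
  q.path.source_drop_one

theorem drop_zero (q : TailClass.{u, v, w} p) : q.drop 0 = q :=
  ext (InfinitePath.ext fun i => congrArg q.path.edge (Nat.zero_add i))

theorem cons_drop_one (q : TailClass.{u, v, w} p)
    (h : E.r (q.path.edge 0) = (q.drop 1).path.source) :
    (q.drop 1).cons (q.path.edge 0) h = q :=
  ext (q.path.cons_drop_one h)

theorem drop_drop (m n : ℕ) (q : TailClass.{u, v, w} p) : (q.drop m).drop n = q.drop (m + n) :=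
  ext (q.path.drop_drop m n)

end TailClass

/-- The underlying vector space of the Chen module of an infinite path. -/
abbrev ChenSpace (K : Type w) [Field K] (p : E.InfinitePath) : Type (max u v w) :=
  TailClass.{u, v, w} p →₀ K

namespace ChenSpace

open Finsupp

variable {K : Type w} [Field K] {p : E.InfinitePath}

open Classical in
/-- The action of a generator on a basis vector of the Chen module. -/
noncomputable def onBasis : E.Generator → TailClass.{u, v, w} p → ChenSpace K p
  | .vertex x, q => if q.path.source = x then single q 1 else 0
  | .edge e, q => if h : E.r e = q.path.source then single (q.cons e h) 1 else 0
  | .ghost e, q => if q.path.edge 0 = e then single (q.drop 1) 1 else 0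

/-- The action of a generator on the Chen module. -/
noncomputable def op (g : E.Generator) : Module.End K (ChenSpace K p) :=
  linearCombination K (onBasis g)

open Classical in
theorem op_vertex_single (x : E.Vertex) (q : TailClass.{u, v, w} p) (c : K) :
    op (.vertex x) (single q c) = if q.path.source = x then single q c else 0 := by
  simp [op, onBasis, apply_ite (c • ·)]

theorem op_edge_single {e : E.Edge} {q : TailClass.{u, v, w} p} (h : E.r e = q.path.source) (c : K) :
    op (.edge e) (single q c) = single (q.cons e h) c := by
  simp [op, onBasis, h]

theorem op_edge_single_of_ne {e : E.Edge} {q : TailClass.{u, v, w} p} (h : E.r e ≠ q.path.source)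
    (c : K) : op (.edge e) (single q c) = 0 := by
  simp [op, onBasis, h]

open Classical in
theorem op_ghost_single (e : E.Edge) (q : TailClass.{u, v, w} p) (c : K) :
    op (.ghost e) (single q c) = if q.path.edge 0 = e then single (q.drop 1) c else 0 := by
  simp [op, onBasis, apply_ite (c • ·)]

theorem end_ext {S T : Module.End K (ChenSpace K p)}
    (h : ∀ q, S (single q 1) = T (single q 1)) : S = T :=
  Finsupp.lhom_ext' fun q => LinearMap.ext_ring (h q)

variable (K p) in
/-- The operators on the Chen module satisfy the relations of the Leavitt path algebra. -/
noncomputable def family : E.LeavittFamily (Module.End K (ChenSpace K p)) where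
  gen := op
  vert_idem x := end_ext fun q => by
    rw [Module.End.mul_apply, op_vertex_single]
    split_ifs with h <;> simp [op_vertex_single, h]
  vert_orth x y hxy := end_ext fun q => by
    rw [Module.End.mul_apply, op_vertex_single]
    split_ifs with h
    · subst h; simp [op_vertex_single, hxy.symm]
    · simp
  source_edge e := end_ext fun q => by
    rw [Module.End.mul_apply]
    by_cases h : E.r e = q.path.source
    · rw [op_edge_single h]
      exact (op_vertex_single _ _ _).trans (if_pos rfl)
    · simp [op_edge_single_of_ne h]
  edge_range e := end_ext fun q => by
    rw [Module.End.mul_apply, op_vertex_single]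
    split_ifs with h
    · rfl
    · rw [op_edge_single_of_ne (Ne.symm h), map_zero]
  range_ghost e := end_ext fun q => by
    rw [Module.End.mul_apply, op_ghost_single]
    split_ifs with h
    · rw [op_vertex_single, if_pos (h ▸ q.source_drop_one)]
    · simp
  ghost_source e := end_ext fun q => by
    rw [Module.End.mul_apply, op_vertex_single, op_ghost_single]
    by_cases h : q.path.edge 0 = e
    · rw [if_pos (show q.path.source = E.s e from congrArg E.s h), op_ghost_single]
    · split_ifs <;> simp [op_ghost_single, h]
  ck1_same e := end_ext fun q => by
    rw [Module.End.mul_apply, op_vertex_single]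
    by_cases h : E.r e = q.path.source
    · rw [op_edge_single h, if_pos h.symm]
      refine (op_ghost_single _ _ _).trans ((if_pos rfl).trans ?_)
      rw [TailClass.drop_one_cons]
    · rw [op_edge_single_of_ne h, map_zero, if_neg (Ne.symm h)]
  ck1_ne e f hef := end_ext fun q => by
    rw [Module.End.mul_apply]
    by_cases h : E.r f = q.path.source
    · rw [op_edge_single h, op_ghost_single, if_neg]
      · rfl
      · exact hef.symm
    · rw [op_edge_single_of_ne h, map_zero]; rfl
  ck2 x hx := end_ext fun q => by
    -- The operator of `ee*` is the projection onto the paths with first edge `e`; over the edges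
    -- emitted by `x` these add up to the projection onto the paths from `x`.
    have hq : ∀ e, (op (.edge e) * op (.ghost e) : Module.End K (ChenSpace K p)) (single q 1) =
        open Classical in if q.path.edge 0 = e then single q 1 else 0 := by
      intro e
      rw [Module.End.mul_apply, op_ghost_single]
      split_ifs with h
      · subst h
        rw [op_edge_single q.source_drop_one.symm, TailClass.cons_drop_one]
      · simp
    refine (op_vertex_single x q 1).trans (Eq.trans ?_ (LinearMap.sum_apply _ _ _).symm)
    simp only [hq]
    refine Eq.trans ?_ (@Finset.sum_ite_eq _ _ _ (fun _ _ => Classical.propDecidable _)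
      (Set.Finite.toFinset hx.2) (q.path.edge 0) fun _ => (single q 1 : ChenSpace K p)).symm
    have hmem : q.path.source = x ↔ q.path.edge 0 ∈ Set.Finite.toFinset hx.2 :=
      (Set.Finite.mem_toFinset hx.2).symm
    by_cases h : q.path.source = x
    · exact (if_pos h).trans (if_pos (hmem.1 h)).symm
    · exact (if_neg h).trans (if_neg (h ∘ hmem.2)).symm

/-- The product of the ghost edges along the first `n` edges of `q`. -/
noncomputable def strip (q : E.InfinitePath) : ℕ → Module.End K (ChenSpace K p)
  | 0 => 1
  | n + 1 => op (.ghost (q.edge n)) * strip q n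

open Classical in
theorem strip_single (q : E.InfinitePath) (n : ℕ) (x : TailClass.{u, v, w} p) (c : K) :
    strip q n (single x c) =
      if ∀ i < n, x.path.edge i = q.edge i then single (x.drop n) c else 0 := by
  induction n with
  | zero =>
    rw [if_pos (by simp), strip, Module.End.one_apply]
    rw [TailClass.drop_zero]
  | succ n ih =>
    rw [strip, Module.End.mul_apply, ih]
    simp only [Nat.forall_lt_succ_right]
    split_ifs with h h' h'
    · rw [← TailClass.drop_drop]
      exact (op_ghost_single _ _ _).trans (if_pos h'.2)
    · exact (op_ghost_single _ _ _).trans (if_neg fun h'' => h' ⟨h, h''⟩)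
    · exact absurd h'.1 h
    · exact map_zero _

theorem strip_self (x : TailClass.{u, v, w} p) (n : ℕ) (c : K) :
    strip x.path n (single x c) = single (x.drop n) c := by
  rw [strip_single, if_pos fun _ _ => rfl]

theorem exists_agree_of_strip_ne_zero {q : E.InfinitePath} {n : ℕ} {m : ChenSpace K p}
    (h : strip q n m ≠ 0) : ∃ x ∈ m.support, ∀ i < n, x.path.edge i = q.edge i := by
  by_contra! hx
  apply h
  rw [← m.sum_single, Finsupp.sum, map_sum]
  refine Finset.sum_eq_zero fun x hxm => ?_
  rw [strip_single, if_neg]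
  intro hi
  obtain ⟨i, hin, hne⟩ := hx x hxm
  exact hne (hi i hin)

/-- Otherwise each of the finitely many paths in the support leaves `q` somewhere, and stripping
beyond the last of the chosen places of disagreement kills `m`. -/
theorem exists_mem_support_path_eq {q : E.InfinitePath} {m : ChenSpace K p}
    (h : ∀ n, strip q n m ≠ 0) : ∃ x ∈ m.support, x.path = q := by
  by_contra! hx
  have hne : ∀ x ∈ m.support, ∃ i, x.path.edge i ≠ q.edge i := by
    intro x hxm
    by_contra! hi
    exact hx x hxm (InfinitePath.ext hi)
  choose! i hi using hne
  -- Stripping `n` edges tests only the indices below `n`, whence the `+ 1`.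
  obtain ⟨x, hxm, hxi⟩ := exists_agree_of_strip_ne_zero (h (m.support.sup i + 1))
  exact hi x hxm (hxi _ (Nat.lt_succ_of_le (Finset.le_sup hxm)))

/-- Once its `q`-term is subtracted, `m` no longer has `q` in its support, so some strip along `q`
annihilates it. -/
theorem exists_strip_eq_single (m : ChenSpace K p) (q : TailClass.{u, v, w} p) :
    ∃ n, strip q.path n m = single (q.drop n) (m q) := by
  by_contra! h
  have hstrip : ∀ n, strip q.path n (m - single q (m q)) ≠ 0 := by
    intro n h0
    rw [map_sub, strip_self, sub_eq_zero] at h0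
    exact h n h0
  obtain ⟨x, hx, hxq⟩ := exists_mem_support_path_eq hstrip
  obtain rfl := TailClass.ext hxq
  simp at hx

/-! ### Simplicity of Chen modules -/

section Invariant

variable {N : AddSubgroup (ChenSpace K p)}
  (hN : ∀ (k : K) (g : E.Generator), ∀ m ∈ N, k • op g m ∈ N)

include hN

theorem op_mem (g : E.Generator) {m : ChenSpace K p} (hm : m ∈ N) : op g m ∈ N := by
  simpa using hN 1 g m hm

theorem strip_mem (q : E.InfinitePath) (n : ℕ) {m : ChenSpace K p} (hm : m ∈ N) :
    strip q n m ∈ N := by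
  induction n with
  | zero => exact hm
  | succ n ih => exact op_mem hN _ ih

theorem single_mem_of_drop (x : TailClass.{u, v, w} p) (n : ℕ) {c : K}
    (h : single (x.drop n) c ∈ N) : single x c ∈ N := by
  induction n generalizing x with
  | zero => rwa [TailClass.drop_zero] at h
  | succ n ih =>
    have h' : single (x.drop 1) c ∈ N := ih _ (by rwa [TailClass.drop_drop, Nat.add_comm])
    have h'' := op_mem hN (.edge (x.path.edge 0)) h'
    rwa [op_edge_single x.source_drop_one.symm, TailClass.cons_drop_one] at h''

/-- `N` is only an additive subgroup; scalars enter through multiples of the source vertex, which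
fixes `x`. -/
theorem smul_single_mem (x : TailClass.{u, v, w} p) {c : K} (h : single x c ∈ N) (k : K) :
    single x (k * c) ∈ N := by
  have h' := hN k (.vertex x.path.source) _ h
  rwa [op_vertex_single, if_pos rfl, smul_single, smul_eq_mul] at h'

/-- Strip a nonzero element to a single path, restore the removed edges, pass to any other path of
the class through a common tail, and rescale. -/
theorem eq_bot_or_eq_top : N = ⊥ ∨ N = ⊤ := by
  refine or_iff_not_imp_left.2 fun hbot => ?_
  obtain ⟨m, hm, hm0⟩ := N.bot_or_exists_ne_zero.resolve_left hbot
  obtain ⟨q, hq⟩ := Finsupp.ne_iff.1 hm0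
  obtain ⟨n, hn⟩ := exists_strip_eq_single m q
  have hqN : single q (m q) ∈ N := single_mem_of_drop hN q n (hn ▸ strip_mem hN _ n hm)
  have hall : ∀ (x : TailClass.{u, v, w} p) (k : K), single x k ∈ N := by
    intro x k
    obtain ⟨i, j, hij⟩ := (q.tailEquivalent.symm.trans x.tailEquivalent).exists_drop_eq
    have h₁ := strip_mem hN q.path j hqN
    rw [strip_self, TailClass.ext (q := q.drop j) (q' := x.drop i) hij] at h₁
    have h₂ := smul_single_mem hN x (single_mem_of_drop hN x i h₁) (k * (m q)⁻¹)
    rwa [inv_mul_cancel_right₀ hq] at h₂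
  refine (AddSubgroup.eq_top_iff' N).2 fun y => ?_
  rw [← y.sum_single]
  exact sum_mem fun x _ => hall x _

end Invariant

end ChenSpace

/-! ### Non-isomorphic Chen modules, left and right -/

section ChenModule

variable (K : Type w) [Field K] {B : Type (max u v w)} [NonUnitalRing B]

/-- The Chen module of an infinite path, as a module over a ring that acts on it by a homomorphism
whose image contains the multiples of the operators given by the generators. -/
noncomputable def chenModule (p : E.InfinitePath) (ρ : B →ₙ+* Module.End K (ChenSpace K p))
    (β : K → E.Generator → B) (hβ : ∀ k g, ρ (β k g) = k • ChenSpace.op g) :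
    SimpleLeftModule B where
  carrier := ChenSpace K p
  act := (Module.toAddMonoidEnd (Module.End K (ChenSpace K p))
    (ChenSpace K p)).toNonUnitalRingHom.comp ρ
  exists_act_ne_zero := by
    refine ⟨β 1 (.vertex p.source), Finsupp.single (TailClass.self p) 1, ?_⟩
    change ρ _ _ ≠ 0
    rw [hβ, one_smul, ChenSpace.op_vertex_single,
      if_pos (show (TailClass.self p).path.source = p.source from rfl)]
    simp
  eq_bot_or_eq_top N hN := ChenSpace.eq_bot_or_eq_top fun k g m hm => by
    have h : ρ (β k g) m ∈ N := hN _ m hm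
    rwa [hβ] at h

/-- No strip along `p` kills the basis vector `p`, hence none kills its image; so `p` itself occurs
in the support of the image, whose paths are tail-equivalent to `q`. -/
theorem tailEquivalent_of_chenModule_iso {p q : E.InfinitePath}
    (ρ : ∀ p : E.InfinitePath, B →ₙ+* Module.End K (ChenSpace K p)) (β : K → E.Generator → B)
    (hβ : ∀ p k g, ρ p (β k g) = k • ChenSpace.op g) (f : ChenSpace K p ≃+ ChenSpace K q)
    (hf : ∀ b m, f (ρ p b m) = ρ q b (f m)) : E.TailEquivalent p q := by
  have hop : ∀ g m, f (ChenSpace.op g m) = ChenSpace.op g (f m) := by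
    intro g m
    simpa [hβ] using hf (β 1 g) m
  have hstrip : ∀ n m, f (ChenSpace.strip p n m) = ChenSpace.strip p n (f m) := by
    intro n m
    induction n with
    | zero => rfl
    | succ n ih => simp only [ChenSpace.strip, Module.End.mul_apply, hop, ih]
  obtain ⟨x, -, hx⟩ := ChenSpace.exists_mem_support_path_eq (q := p)
    (m := f (Finsupp.single (TailClass.self p) 1)) fun n => by
      rw [← hstrip, ne_eq, EmbeddingLike.map_eq_zero_iff]
      exact (ChenSpace.strip_self (TailClass.self p) n (1 : K)).symm ▸ by simp
  exact (hx ▸ x.tailEquivalent).symm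

theorem not_countable_isoClass (ρ : ∀ p : E.InfinitePath, B →ₙ+* Module.End K (ChenSpace K p))
    (β : K → E.Generator → B) (hβ : ∀ p k g, ρ p (β k g) = k • ChenSpace.op g)
    {S : Set E.InfinitePath} (hS : ¬ S.Countable)
    (hp : S.Pairwise fun p q => ¬ E.TailEquivalent p q) :
    ¬ Countable (SimpleLeftModule.IsoClass B) := by
  intro hc
  let F : S → SimpleLeftModule.IsoClass B := fun p =>
    Quotient.mk (SimpleLeftModule.isoSetoid B) (chenModule K p.1 (ρ p) β (hβ p))
  refine hS (Function.Injective.countable (f := F) fun p q h => Subtype.ext ?_ : Countable S)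
  obtain ⟨f, hf⟩ := Quotient.exact h
  by_contra hne
  exact hp p.2 q.2 hne (tailEquivalent_of_chenModule_iso K ρ β hβ f hf)

variable (E)

theorem not_isLeftCIRT {S : Set E.InfinitePath} (hS : ¬ S.Countable)
    (hp : S.Pairwise fun p q => ¬ E.TailEquivalent p q) :
    ¬ IsLeftCIRT (E.LeavittPathAlgebra K) :=
  not_countable_isoClass K (fun p => (ChenSpace.family K p).lift K)
    (LeavittPathAlgebra.smulGen K) (fun p => (ChenSpace.family K p).lift_smulGen K) hS hp

/-- The action of the opposite of the Leavitt path algebra on the Chen module. -/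
noncomputable def chenOpAction (p : E.InfinitePath) :
    (E.LeavittPathAlgebra K)ᵐᵒᵖ →ₙ+* Module.End K (ChenSpace K p) where
  toFun a := ((ChenSpace.family K p).op.lift K a.unop).unop
  map_zero' := by simp
  map_add' a b := by simp
  map_mul' a b := by simp

theorem not_isRightCIRT {S : Set E.InfinitePath} (hS : ¬ S.Countable)
    (hp : S.Pairwise fun p q => ¬ E.TailEquivalent p q) :
    ¬ IsRightCIRT (E.LeavittPathAlgebra K) :=
  not_countable_isoClass K (E.chenOpAction K)
    -- The right action already applies the involution, so `g.star` acts as `g`.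
    (fun k g => .op (LeavittPathAlgebra.smulGen K k g.star)) (fun p k g => by
      change (((ChenSpace.family K p).op.lift K (LeavittPathAlgebra.smulGen K k g.star))).unop = _
      rw [LeavittFamily.lift_smulGen]
      change k • ChenSpace.op g.star.star = _
      rw [g.star_star]) hS hp

end ChenModule

end DirectedGraph

theorem proposition3p3 (K : Type w) [Field K] (E : DirectedGraph.{u, v}) (hE : Nonempty E.Vertex) :
    (IsLeftCIRT (E.LeavittPathAlgebra K) ∨ IsRightCIRT (E.LeavittPathAlgebra K) →
      (∃ x : E.Vertex, E.IsLinePoint x) ∨ E.HasCycleWithoutExits) ∧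
    ((¬ ∃ x : E.Vertex, E.IsLinePoint x) → ¬ E.HasCycleWithoutExits →
      ∃ S : Set E.InfinitePath, Cardinal.mk S = Cardinal.continuum ∧
        S.Pairwise fun p q => ¬ E.TailEquivalent p q) := by
  have key : (¬ ∃ x : E.Vertex, E.IsLinePoint x) → ¬ E.HasCycleWithoutExits →
      ∃ S : Set E.InfinitePath, Cardinal.mk S = Cardinal.continuum ∧
        S.Pairwise fun p q => ¬ E.TailEquivalent p q := by
    intro hl hc
    obtain ⟨D⟩ := DirectedGraph.nonempty_branchingData fun x => by
      obtain ⟨y, hxy, hy⟩ := DirectedGraph.exists_reaches_bifurcation hl hc x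
      exact DirectedGraph.exists_bifurcatesAfter hxy hy
    exact D.exists_pairwise_not_tailEquivalent hE.some
  refine ⟨fun h => ?_, key⟩
  by_contra! hcon
  obtain ⟨S, hS, hp⟩ := key (not_exists.2 hcon.1) hcon.2
  have hS' : ¬ S.Countable := by
    rw [← Cardinal.le_aleph0_iff_set_countable, hS, not_le]
    exact Cardinal.aleph0_lt_continuum
  exact h.elim (E.not_isLeftCIRT K hS' hp) (E.not_isRightCIRT K hS' hp)
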